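/- Let $m\ge 0$ and let $P\in\mathbb{R}[x_0,\dots,x_m]$ be a Lorentzian polynomial of total degree $n$. Let $\alpha=(\alpha_0,\dots,\alpha_m)\in\mathbb{R}_{\ge 0}^{m+1}$, and suppose that for some index $i$ the coordinate $\alpha_i=k$ is a nonnegative integer. Let $\alpha^*\in\mathbb{R}_{\ge 0}^{m}$ be $\alpha$ with the $i$-th coordinate removed. Then $$\mathrm{cap}_{\alpha}(P)\cdot\binom{n}{k}\Bigl(\frac{k}{n}\Bigr)^{k}\Bigl(\frac{n-k}{n}\Bigr)^{n-k}\;\le\;\frac{1}{k!}\,\mathrm{cap}_{\alpha^*}\Bigl(\frac{\partial^k P}{\partial x_i^k}\Big|_{x_i=0}\Bigr),$$ where the polynomial on the right is regarded as a polynomial in the remaining $m$ variables. Here $0^0=1$, the factor multiplying $\mathrm{cap}_\alpha(P)$ is read as $1$ if $n=k=0$, and it is $0$ if $k>n$. The notions used are as follows. For a polynomial $Q$ with nonnegative real coefficients in variables indexed by a finite set $J$, and $\beta\in\mathbb{R}_{\ge0}^J$, $$\mathrm{cap}_\beta(Q)=\inf_{x\in\mathbb{R}_{>0}^J}\frac{Q(x)}{\prod_{j\in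 J}x_j^{\beta_j}}.$$ A polynomial with real coefficients is real stable if it is identically zero or has no zero $z$ with $\mathrm{Im}(z_j)>0$ for all $j$. A set $S\subseteq\mathbb{N}^J$ (possibly empty) is M-convex if for all $a,b\in S$ and every $i$ with $a_i>b_i$ there is $j$ with $a_j<b_j$ such that $a-e_i+e_j\in S$ and $b-e_j+e_i\in S$. Lorentzian polynomials are defined recursively: a homogeneous polynomial of degree at most $2$ is Lorentzian if it is real stable and has nonnegative coefficients; a homogeneous polynomial of degree $d\ge3$ is Lorentzian if the set of exponents of its monomials with nonzero coefficient is M-convex and each of its first partial derivatives is a Lorentzian polynomial of degree $d-1$ (the zero polynomial counting as homogeneous of every degree). -/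

import Mathlib

open MvPolynomial

/-- A real polynomial is (real) stable if it is identically zero or has no zero all of whose
coordinates lie in the open upper half plane. -/
def IsRealStable {σ : Type*} (P : MvPolynomial σ ℝ) : Prop :=
  P = 0 ∨ ∀ z : σ → ℂ, (∀ j, 0 < (z j).im) → aeval z P ≠ 0

/-- M-convexity of a set of exponent vectors (symmetric exchange property): for `a, b ∈ S` and
`a i > b i` there is `j` with `a j < b j` such that `a - e_i + e_j` and `b - e_j + e_i` belong
to `S`. The subtractions are honest because `a i ≥ 1` and `b j ≥ 1`. The empty set, the support
of the zero polynomial, is allowed. -/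
def IsMConvex {σ : Type*} (S : Set (σ →₀ ℕ)) : Prop :=
  ∀ a ∈ S, ∀ b ∈ S, ∀ i, b i < a i →
    ∃ j, a j < b j ∧
      a - Finsupp.single i 1 + Finsupp.single j 1 ∈ S ∧
      b - Finsupp.single j 1 + Finsupp.single i 1 ∈ S

/-- Lorentzian forms of degree `d`. In degree at most two: homogeneous, real stable, with
nonnegative coefficients. In degree at least three: homogeneous, with M-convex support, and such
that each first partial derivative is Lorentzian. -/
inductive IsLorentzianOfDegree {σ : Type*} : ℕ → MvPolynomial σ ℝ → Prop
  | low {d : ℕ} {P : MvPolynomial σ ℝ} (hd : d ≤ 2) (hom : P.IsHomogeneous d)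
      (nonneg : ∀ a, 0 ≤ P.coeff a) (stable : IsRealStable P) : IsLorentzianOfDegree d P
  | high {d : ℕ} {P : MvPolynomial σ ℝ} (hd : 2 ≤ d) (hom : P.IsHomogeneous (d + 1))
      (supp : IsMConvex (P.support : Set (σ →₀ ℕ)))
      (deriv : ∀ i, IsLorentzianOfDegree d (pderiv i P)) : IsLorentzianOfDegree (d + 1) P

/-- A polynomial is Lorentzian if it is a Lorentzian form of some degree. -/
def IsLorentzian {σ : Type*} (P : MvPolynomial σ ℝ) : Prop :=
  ∃ d, IsLorentzianOfDegree d P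

/-- The capacity `inf_{x > 0} P(x) / ∏ x_j ^ α_j`. For `P` with nonnegative coefficients the
infimum is over a nonempty set that is bounded below by `0`. -/
noncomputable def capacity {σ : Type*} [Fintype σ] (α : σ → ℝ) (P : MvPolynomial σ ℝ) : ℝ :=
  ⨅ x : {x : σ → ℝ // ∀ j, 0 < x j}, eval x.1 P / ∏ j, x.1 j ^ α j

/-- The polynomial `∂^k P / ∂x_i^k` restricted to `x_i = 0`, as a polynomial in the remaining
`m` variables. -/
noncomputable def derivRestrict {m : ℕ} (i : Fin (m + 1)) (k : ℕ)
    (P : MvPolynomial (Fin (m + 1)) ℝ) : MvPolynomial (Fin m) ℝ :=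
  aeval (i.insertNth (α := fun _ => MvPolynomial (Fin m) ℝ) 0 X) ((pderiv i)^[k] P)

/-! Fix positive values `y` of the variables other than `x_i`. Then `P` becomes a univariate
polynomial `∑ c_j t^j`, and the polynomial on the right takes the value `k! c_k` at `y`. Since `α_i
= k`, the definition of capacity gives `C t^k ≤ ∑ c_j t^j` for all `t > 0`, where `C` is the
capacity of `P` times the monomial in `y`. It remains to bound `c_k` below by `C` times the stated
constant, uniformly in `y`.

This works when `c` is ultra log-concave without internal zeros
(`mul_le_coeff_of_ultra_log_concave`). The normalized sequence `a_j = c_j / binom(n, j)` then lies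
below a geometric sequence of some ratio `r` that touches it at `k`. So at `t = s / r` the
polynomial is at most `a_k r^(-k) (1 + s)^n`, and the optimal `s = k / (n - k)` produces the
constant.

In degree at least three the absence of internal zeros is M-convexity; in degree two it follows from
ultra log-concavity. The latter is the reverse Cauchy–Schwarz inequality for the Hessian of `∂_i^j
P` in the direction `e_i`, in the limit `t → 0`. The Hessian inequality
(`IsLorentzianOfDegree.hessian_mul_le_sq`) is proved by induction on the degree. A stable quadratic
violating it would have a zero in the upper half plane. In higher degree, Euler's identity averages
the inequalities for the `∂_l P` into `A ≤ A²` for the normalized Hessian `A`. Its positive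
eigenvalues are thus at least `1`, which is also its Perron eigenvalue, and M-convexity supplies the
connectedness that makes it simple. -/

/-! ### Symmetric matrices with at most one positive eigenvalue -/

open Matrix in
/-- A symmetric matrix is nonpositive on vectors orthogonal to all eigenvectors of positive
eigenvalue. -/
theorem Matrix.IsHermitian.dotProduct_mulVec_nonpos {ι : Type*} [Fintype ι] [DecidableEq ι]
    {M : Matrix ι ι ℝ} (hM : M.IsHermitian) (x : ι → ℝ)
    (hx : ∀ (μ : ℝ) (w : ι → ℝ), 0 < μ → M *ᵥ w = μ • w → x ⬝ᵥ w = 0) :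
    x ⬝ᵥ M *ᵥ x ≤ 0 := by
  have key := hM.eigenvectorBasis.sum_inner_mul_inner (WithLp.toLp 2 x) (WithLp.toLp 2 (M *ᵥ x))
  have h1 : inner ℝ (WithLp.toLp 2 x) (WithLp.toLp 2 (M *ᵥ x)) = x ⬝ᵥ M *ᵥ x := by
    simp [EuclideanSpace.inner_eq_star_dotProduct, dotProduct_comm]
  rw [← h1, ← key]
  refine Finset.sum_nonpos fun k _ => ?_
  set w : ι → ℝ := (hM.eigenvectorBasis k).ofLp with hw
  have e1 : inner ℝ (WithLp.toLp 2 x) (hM.eigenvectorBasis k) = x ⬝ᵥ w := by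
    simp [EuclideanSpace.inner_eq_star_dotProduct, dotProduct_comm, hw]
  have hMw : M *ᵥ w = hM.eigenvalues k • w := hM.mulVec_eigenvectorBasis k
  have e2 : inner ℝ (hM.eigenvectorBasis k) (WithLp.toLp 2 (M *ᵥ x)) =
      hM.eigenvalues k * (x ⬝ᵥ w) := by
    have : inner ℝ (hM.eigenvectorBasis k) (WithLp.toLp 2 (M *ᵥ x)) = w ⬝ᵥ M *ᵥ x := by
      simp [EuclideanSpace.inner_eq_star_dotProduct, dotProduct_comm, hw]
    rw [this, dotProduct_mulVec, ← mulVec_transpose]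
    have hT : Mᵀ = M := by simpa [conjTranspose_eq_transpose_of_trivial] using hM.eq
    rw [hT, hMw, smul_dotProduct, dotProduct_comm, smul_eq_mul]
  rw [e1, e2]
  rcases lt_or_ge 0 (hM.eigenvalues k) with h | h
  · rw [hx _ _ h hMw]; simp
  · nlinarith [mul_nonneg (neg_nonneg.2 h) (mul_self_nonneg (x ⬝ᵥ w))]

open Matrix in
/-- Twice the difference between the diagonal form of the row sums and the quadratic form is a
weighted Laplacian. -/
theorem Matrix.sum_mul_sq_sub_eq {ι : Type*} [Fintype ι] {H : Matrix ι ι ℝ} (hH : H.IsSymm)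
    {y : ι → ℝ} (hy : ∀ i, 0 < y i) (v : ι → ℝ) :
    ∑ i, ∑ j, H i j * y i * y j * (v i / y i - v j / y j) ^ 2 =
      2 * (∑ i, v i ^ 2 * (H *ᵥ y) i / y i - v ⬝ᵥ H *ᵥ v) := by
  have e : ∀ i j, H i j * y i * y j * (v i / y i - v j / y j) ^ 2 =
      v i ^ 2 / y i * (H i j * y j) + v j ^ 2 / y j * (H j i * y i) -
        2 * (v i * (H i j * v j)) := by
    intro i j
    rw [hH.apply i j]
    have := (hy i).ne'
    have := (hy j).ne'
    field_simp
    ring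
  have e1 : ∑ i, ∑ j, v i ^ 2 / y i * (H i j * y j) = ∑ i, v i ^ 2 * (H *ᵥ y) i / y i := by
    refine Finset.sum_congr rfl fun i _ => ?_
    rw [← Finset.mul_sum, mulVec, dotProduct]
    ring
  have e2 : ∑ i, ∑ j, v i * (H i j * v j) = v ⬝ᵥ H *ᵥ v := by
    simp only [mulVec, dotProduct, Finset.mul_sum]
  have e3 : ∑ i, ∑ j, 2 * (v i * (H i j * v j)) = 2 * (v ⬝ᵥ H *ᵥ v) := by
    simp only [← e2, Finset.mul_sum]
  simp only [e, Finset.sum_sub_distrib, Finset.sum_add_distrib]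
  rw [Finset.sum_comm (f := fun i j => v j ^ 2 / y j * (H j i * y i)), e1, e3]
  ring

open Matrix in
/-- If a connected symmetric matrix with nonnegative entries satisfies the inequality
`A ≤ A²` for its normalization `A` with Perron vector `y`, then it has at most one positive
eigenvalue: it is nonpositive on the orthogonal complement of `H y`. -/
theorem Matrix.IsSymm.dotProduct_mulVec_nonpos_of_connected {ι : Type*} [Fintype ι]
    {H : Matrix ι ι ℝ} (hH : H.IsSymm) (hpos : ∀ i j, 0 ≤ H i j)
    {y : ι → ℝ} (hy : ∀ i, 0 < y i)
    (hsq : ∀ v : ι → ℝ, v ⬝ᵥ H *ᵥ v ≤ ∑ i, y i * ((H *ᵥ v) i ^ 2 / (H *ᵥ y) i))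
    (hconn : ∀ i j, (H *ᵥ y) i ≠ 0 → (H *ᵥ y) j ≠ 0 →
      ∃ l, (i = l ∨ H i l ≠ 0) ∧ (l = j ∨ H l j ≠ 0))
    (v : ι → ℝ) (hv : v ⬝ᵥ H *ᵥ y = 0) : v ⬝ᵥ H *ᵥ v ≤ 0 := by
  classical
  set r := H *ᵥ y with hr
  have hr0 : ∀ i, 0 ≤ r i := fun i =>
    Finset.sum_nonneg fun j _ => mul_nonneg (hpos i j) (hy j).le
  have hrow : ∀ i, r i = 0 → ∀ j, H i j = 0 := by
    intro i hi j
    have := (Finset.sum_eq_zero_iff_of_nonneg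
      (fun j _ => mul_nonneg (hpos i j) (hy j).le)).1 hi j (Finset.mem_univ _)
    exact (mul_eq_zero.1 this).resolve_right (hy j).ne'
  -- `M = (s_i H_ij s_j)` is the symmetric normalization of `H`, and `u` is its Perron vector, of
  -- eigenvalue `1`. On zero rows `y i / 0 = 0` makes `s` vanish, which removes these indices from
  -- `M`.
  set s : ι → ℝ := fun i => √(y i / r i) with hs
  set u : ι → ℝ := fun i => √(y i * r i) with hu
  have hs2 : ∀ i, s i ^ 2 = y i / r i := fun i =>
    Real.sq_sqrt (div_nonneg (hy i).le (hr0 i))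
  have hs0 : ∀ i, r i = 0 → s i = 0 := fun i hi => by simp [hs, hi]
  have hspos : ∀ i, r i ≠ 0 → 0 < s i := fun i hi =>
    Real.sqrt_pos.2 (div_pos (hy i) ((hr0 i).lt_of_ne' hi))
  have hus : ∀ i, r i ≠ 0 → u i = r i * s i := by
    intro i hi
    have hri := (hr0 i).lt_of_ne' hi
    rw [hu, Real.sqrt_eq_iff_mul_self_eq (mul_nonneg (hy i).le (hr0 i))
      (mul_nonneg (hr0 i) (hspos i hi).le)]
    have := hs2 i
    rw [eq_div_iff hi] at this
    linear_combination -r i * this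
  have hu0 : ∀ i, r i = 0 → u i = 0 := fun i hi => by simp [hu, hi]
  set M : Matrix ι ι ℝ := Matrix.of fun i j => s i * H i j * s j with hMdef
  have hM : M.IsHermitian := by
    ext i j
    simp [hMdef, hH.apply i j]
    ring
  have hMw : ∀ w i, (M *ᵥ w) i = s i * (H *ᵥ fun j => s j * w j) i := by
    intro w i
    simp only [mulVec, dotProduct, hMdef, Matrix.of_apply, Finset.mul_sum]
    exact Finset.sum_congr rfl fun j _ => by ring
  -- With `W = |w|²`, `hsq` gives `μ W ≤ μ² W`, so `W ≤ μ W`. The Laplacian sum equals `2 (W - μ W)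
  -- ≤ 0` and has nonnegative terms, so all of them vanish. Hence `x / y` is constant along edges,
  -- and by `hconn` on all nonzero rows.
  have eig : ∀ (μ : ℝ) (w : ι → ℝ), 0 < μ → M *ᵥ w = μ • w → ∃ c : ℝ, w = c • u := by
    intro μ w hμ hw
    set x : ι → ℝ := fun j => s j * w j with hx
    have hsx : ∀ i, s i * (H *ᵥ x) i = μ * w i := fun i => by
      rw [← hMw, hw]; rfl
    have hw0 : ∀ i, r i = 0 → w i = 0 := by
      intro i hi
      have := hsx i
      rw [hs0 i hi, zero_mul, eq_comm, mul_eq_zero] at this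
      exact this.resolve_left hμ.ne'
    have hquad : x ⬝ᵥ H *ᵥ x = μ * ∑ i, w i ^ 2 := by
      rw [dotProduct, Finset.mul_sum]
      refine Finset.sum_congr rfl fun i _ => ?_
      simp only [hx] at hsx ⊢
      linear_combination w i * hsx i
    have hle := hsq x
    have hrhs : ∑ i, y i * ((H *ᵥ x) i ^ 2 / r i) = μ ^ 2 * ∑ i, w i ^ 2 := by
      rw [Finset.mul_sum]
      refine Finset.sum_congr rfl fun i _ => ?_
      rw [← mul_pow, ← hsx i, mul_pow, hs2]
      ring
    rw [hquad, hrhs] at hle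
    set W := ∑ i, w i ^ 2 with hW
    have hW0 : 0 ≤ W := Finset.sum_nonneg fun i _ => sq_nonneg _
    have hWμ : W ≤ μ * W := by
      have : μ * W ≤ μ * (μ * W) := by linarith [hle, sq μ]
      exact le_of_mul_le_mul_left this hμ
    have hlap := sum_mul_sq_sub_eq hH hy x
    have hdiag : ∑ i, x i ^ 2 * (H *ᵥ y) i / y i = W := by
      refine Finset.sum_congr rfl fun i _ => ?_
      by_cases hi : r i = 0
      · rw [← hr, hi, hw0 i hi]; simp
      · rw [← hr, hx]
        simp only
        rw [mul_pow, hs2]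
        have := (hy i).ne'
        field_simp
    rw [hdiag, hquad] at hlap
    have hnn : ∀ i j, 0 ≤ H i j * y i * y j * (x i / y i - x j / y j) ^ 2 := fun i j =>
      mul_nonneg (mul_nonneg (mul_nonneg (hpos i j) (hy i).le) (hy j).le) (sq_nonneg _)
    have hsum0 : ∑ i, ∑ j, H i j * y i * y j * (x i / y i - x j / y j) ^ 2 = 0 :=
      le_antisymm (by rw [hlap]; linarith)
        (Finset.sum_nonneg fun i _ => Finset.sum_nonneg fun j _ => hnn i j)
    have hadj : ∀ i j, H i j ≠ 0 → x i / y i = x j / y j := by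
      intro i j hij
      have h1 := (Finset.sum_eq_zero_iff_of_nonneg
        (fun i _ => Finset.sum_nonneg fun j _ => hnn i j)).1 hsum0 i (Finset.mem_univ _)
      have h2 := (Finset.sum_eq_zero_iff_of_nonneg
        (fun j _ => hnn i j)).1 h1 j (Finset.mem_univ _)
      have h3 : H i j * y i * y j ≠ 0 := mul_ne_zero (mul_ne_zero hij (hy i).ne') (hy j).ne'
      have := (mul_eq_zero.1 h2).resolve_left h3
      exact sub_eq_zero.1 (pow_eq_zero_iff two_ne_zero |>.1 this)
    have hconst : ∀ i j, r i ≠ 0 → r j ≠ 0 → x i / y i = x j / y j := by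
      intro i j hi hj
      obtain ⟨l, h1, h2⟩ := hconn i j hi hj
      have e1 : x i / y i = x l / y l := by
        rcases h1 with rfl | h1
        · rfl
        · exact hadj _ _ h1
      have e2 : x l / y l = x j / y j := by
        rcases h2 with rfl | h2
        · rfl
        · exact hadj _ _ h2
      exact e1.trans e2
    by_cases hex : ∃ i, r i ≠ 0
    · obtain ⟨i₀, hi₀⟩ := hex
      refine ⟨x i₀ / y i₀, funext fun i => ?_⟩
      by_cases hi : r i = 0
      · simp [hw0 i hi, hu0 i hi]
      · rw [Pi.smul_apply, smul_eq_mul, hconst i₀ i hi₀ hi, hus i hi]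
        have h1 := hs2 i
        rw [eq_div_iff hi] at h1
        have := (hy i).ne'
        simp only [hx]
        field_simp
        linear_combination - w i * h1
    · push Not at hex
      exact ⟨0, funext fun i => by simp [hw0 i (hex i)]⟩
  -- This undoes the normalization: `x ⬝ u = v ⬝ H y` and `x ⬝ M x = v ⬝ H v`. Where `s i = 0` the
  -- entry of `x` is `0`, harmless since that row and column of `H` vanish.
  set x : ι → ℝ := fun i => v i / s i with hx
  have hxu : x ⬝ᵥ u = 0 := by
    rw [← hv]
    refine Finset.sum_congr rfl fun i _ => ?_
    by_cases hi : r i = 0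
    · rw [hi, hu0 i hi]; simp
    · rw [hus i hi, hx]
      have := (hspos i hi).ne'
      field_simp
  have hmain := hM.dotProduct_mulVec_nonpos x fun μ w hμ hw => by
    obtain ⟨c, rfl⟩ := eig μ w hμ hw
    rw [dotProduct_smul, hxu, smul_zero]
  convert hmain using 1
  refine Finset.sum_congr rfl fun i _ => ?_
  rw [hMw]
  have hcol : (H *ᵥ fun j => s j * x j) i = (H *ᵥ v) i := by
    refine Finset.sum_congr rfl fun j _ => ?_
    beta_reduce
    by_cases hj : r j = 0
    · rw [← hH.apply i j, hrow j hj i]; simp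
    · have := (hspos j hj).ne'
      simp only [hx]
      field_simp
  rw [hcol]
  by_cases hi : r i = 0
  · have : (H *ᵥ v) i = 0 := Finset.sum_eq_zero fun j _ => by
      beta_reduce
      rw [hrow i hi j, zero_mul]
    rw [this]; simp
  · have := (hspos i hi).ne'
    simp only [hx]
    field_simp

open Matrix in
/-- Reverse Cauchy–Schwarz inequality from nonpositivity on the orthogonal complement of `H y`. -/
theorem Matrix.IsSymm.mul_le_sq_of_nonpos {ι : Type*} [Fintype ι]
    {H : Matrix ι ι ℝ} (hH : H.IsSymm) {y : ι → ℝ} (hyy : 0 ≤ y ⬝ᵥ H *ᵥ y)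
    (hneg : ∀ v : ι → ℝ, v ⬝ᵥ H *ᵥ y = 0 → v ⬝ᵥ H *ᵥ v ≤ 0) (v : ι → ℝ) :
    (v ⬝ᵥ H *ᵥ v) * (y ⬝ᵥ H *ᵥ y) ≤ (v ⬝ᵥ H *ᵥ y) ^ 2 := by
  rcases hyy.eq_or_lt with h0 | h0
  · rw [← h0, mul_zero]; positivity
  have hsymm : y ⬝ᵥ H *ᵥ v = v ⬝ᵥ H *ᵥ y := by
    rw [dotProduct_mulVec, ← mulVec_transpose, hH.eq, dotProduct_comm]
  set c := (v ⬝ᵥ H *ᵥ y) / (y ⬝ᵥ H *ᵥ y) with hc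
  have hcy : c * (y ⬝ᵥ H *ᵥ y) = v ⬝ᵥ H *ᵥ y := div_mul_cancel₀ _ h0.ne'
  have := hneg (v - c • y) (by
    rw [sub_dotProduct, smul_dotProduct, smul_eq_mul, hcy, sub_self])
  simp only [sub_dotProduct, mulVec_sub, dotProduct_sub, smul_dotProduct, mulVec_smul,
    dotProduct_smul, smul_eq_mul, hsymm] at this
  nlinarith [mul_le_mul_of_nonneg_right this h0.le]

/-! ### Partial derivatives, Euler's identity and Hessians -/

theorem MvPolynomial.pderiv_comm {σ : Type*} (i j : σ) (P : MvPolynomial σ ℝ) :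
    pderiv i (pderiv j P) = pderiv j (pderiv i P) := by
  classical
  ext a
  simp only [coeff_pderiv, Finsupp.add_apply, Finsupp.single_apply]
  rw [add_right_comm a]
  by_cases h : i = j
  · subst h; rfl
  · simp [h, Ne.symm h]; ring

theorem MvPolynomial.coeff_pderiv_nonneg {σ : Type*} {P : MvPolynomial σ ℝ}
    (hP : ∀ a, 0 ≤ P.coeff a) (i : σ) (a : σ →₀ ℕ) : 0 ≤ (pderiv i P).coeff a := by
  rw [coeff_pderiv]
  exact mul_nonneg (hP _) (by positivity)

theorem MvPolynomial.eval_pos_of_coeff_nonneg {σ : Type*} {P : MvPolynomial σ ℝ}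
    (hP : ∀ a, 0 ≤ P.coeff a) (h0 : P ≠ 0) {y : σ → ℝ} (hy : ∀ i, 0 < y i) : 0 < eval y P := by
  rw [eval_eq]
  refine Finset.sum_pos (fun a ha => ?_) (support_nonempty.2 h0)
  exact mul_pos ((hP a).lt_of_ne' (mem_support_iff.1 ha))
    (Finset.prod_pos fun i _ => pow_pos (hy i) _)

theorem MvPolynomial.eval_nonneg_of_coeff_nonneg {σ : Type*} {P : MvPolynomial σ ℝ}
    (hP : ∀ a, 0 ≤ P.coeff a) {y : σ → ℝ} (hy : ∀ i, 0 ≤ y i) : 0 ≤ eval y P := by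
  rw [eval_eq]
  exact Finset.sum_nonneg fun a _ =>
    mul_nonneg (hP a) (Finset.prod_nonneg fun i _ => pow_nonneg (hy i) _)

theorem MvPolynomial.pderiv_ne_zero_iff {σ : Type*} {P : MvPolynomial σ ℝ} {i : σ} :
    pderiv i P ≠ 0 ↔ ∃ a ∈ P.support, a i ≠ 0 := by
  classical
  constructor
  · intro h
    obtain ⟨a, ha⟩ := support_nonempty.2 h
    rw [mem_support_iff, coeff_pderiv] at ha
    exact ⟨_, mem_support_iff.2 (left_ne_zero_of_mul ha), by simp⟩
  · rintro ⟨a, ha, hi⟩ h0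
    have h1 : a - Finsupp.single i 1 + Finsupp.single i 1 = a :=
      tsub_add_cancel_of_le (Finsupp.single_le_iff.2 (Nat.one_le_iff_ne_zero.2 hi))
    have h2 := coeff_pderiv (i := i) P (a - Finsupp.single i 1)
    rw [h0, h1, coeff_zero, eq_comm, mul_eq_zero] at h2
    rcases h2 with h2 | h2
    · exact mem_support_iff.1 ha h2
    · exact absurd h2 (by positivity)

theorem MvPolynomial.IsHomogeneous.sum_mul_aeval_pderiv {σ A : Type*} [Fintype σ] [CommRing A]
    [Algebra ℝ A] {P : MvPolynomial σ ℝ} {d : ℕ} (hP : P.IsHomogeneous d) (z : σ → A) :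
    ∑ i, z i * MvPolynomial.aeval z (pderiv i P) = d * MvPolynomial.aeval z P := by
  have := congrArg (MvPolynomial.aeval z) hP.sum_X_mul_pderiv
  simpa using this

theorem MvPolynomial.IsHomogeneous.sum_mul_eval_pderiv {σ : Type*} [Fintype σ]
    {P : MvPolynomial σ ℝ} {d : ℕ} (hP : P.IsHomogeneous d) (z : σ → ℝ) :
    ∑ i, z i * eval z (pderiv i P) = d * eval z P := by
  simpa [coe_aeval_eq_eval] using hP.sum_mul_aeval_pderiv z

/-- The Hessian matrix of a polynomial at a point. -/
noncomputable def MvPolynomial.hessian {σ : Type*} (P : MvPolynomial σ ℝ) (y : σ → ℝ) :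
    Matrix σ σ ℝ :=
  Matrix.of fun i j => eval y (pderiv i (pderiv j P))

theorem MvPolynomial.hessian_apply {σ : Type*} (P : MvPolynomial σ ℝ) (y : σ → ℝ) (i j : σ) :
    P.hessian y i j = eval y (pderiv i (pderiv j P)) := rfl

theorem MvPolynomial.isSymm_hessian {σ : Type*} (P : MvPolynomial σ ℝ) (y : σ → ℝ) :
    (P.hessian y).IsSymm := by
  ext i j
  simp [hessian_apply, pderiv_comm i j]

open Matrix in
theorem MvPolynomial.IsHomogeneous.hessian_mulVec_self {σ : Type*} [Fintype σ]
    {P : MvPolynomial σ ℝ} {d : ℕ} (hP : P.IsHomogeneous d) (y : σ → ℝ) (i : σ) :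
    (P.hessian y *ᵥ y) i = (d - 1 : ℕ) * eval y (pderiv i P) := by
  rw [← (hP.pderiv (i := i)).sum_mul_eval_pderiv y]
  refine Finset.sum_congr rfl fun j _ => ?_
  beta_reduce
  rw [hessian_apply, pderiv_comm, mul_comm]

open Matrix in
theorem MvPolynomial.IsHomogeneous.dotProduct_hessian_mulVec_self {σ : Type*} [Fintype σ]
    {P : MvPolynomial σ ℝ} {d : ℕ} (hP : P.IsHomogeneous d) (y : σ → ℝ) :
    y ⬝ᵥ P.hessian y *ᵥ y = (d - 1 : ℕ) * (d * eval y P) := by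
  simp_rw [dotProduct, hP.hessian_mulVec_self, ← hP.sum_mul_eval_pderiv y, Finset.mul_sum]
  exact Finset.sum_congr rfl fun i _ => by ring

/-! ### Reverse Cauchy–Schwarz for Hessians of Lorentzian forms -/

theorem IsLorentzianOfDegree.isHomogeneous {σ : Type*} {d : ℕ} {P : MvPolynomial σ ℝ}
    (hP : IsLorentzianOfDegree d P) : P.IsHomogeneous d := by
  cases hP <;> assumption

/-- The definition imposes this only in degree at most two. It propagates upwards because each
coefficient of a form of positive degree is, up to a positive factor, a coefficient of some first
derivative. -/
theorem IsLorentzianOfDegree.coeff_nonneg {σ : Type*} {d : ℕ} {P : MvPolynomial σ ℝ}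
    (hP : IsLorentzianOfDegree d P) (a : σ →₀ ℕ) : 0 ≤ P.coeff a := by
  induction hP generalizing a with
  | low hd hom nonneg stable => exact nonneg a
  | @high d P hd hom supp deriv ih =>
    by_cases h : P.coeff a = 0
    · exact h.ge
    have hdeg : a.degree = d + 1 := by
      by_contra hne
      exact h (hom.coeff_eq_zero hne)
    have hne : a ≠ 0 := by
      rintro rfl
      simp at hdeg
    obtain ⟨i, hi⟩ := Finsupp.ne_iff.1 hne
    have h1 : a - Finsupp.single i 1 + Finsupp.single i 1 = a :=
      tsub_add_cancel_of_le (Finsupp.single_le_iff.2 (Nat.one_le_iff_ne_zero.2 hi))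
    have h2 := ih i (a - Finsupp.single i 1)
    rw [coeff_pderiv, h1] at h2
    exact nonneg_of_mul_nonneg_left h2 (by positivity)

open Matrix in
/-- The Hessian of a real stable form of degree at most two satisfies the reverse
Cauchy–Schwarz inequality. -/
theorem IsRealStable.hessian_mul_le_sq {σ : Type*} [Fintype σ] {P : MvPolynomial σ ℝ}
    (hP : IsRealStable P) {d : ℕ} (hd : d ≤ 2) (hom : P.IsHomogeneous d)
    (nonneg : ∀ a, 0 ≤ P.coeff a) {y : σ → ℝ} (hy : ∀ i, 0 < y i) (v : σ → ℝ) :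
    (v ⬝ᵥ P.hessian y *ᵥ v) * (y ⬝ᵥ P.hessian y *ᵥ y) ≤ (v ⬝ᵥ P.hessian y *ᵥ y) ^ 2 := by
  by_contra! hlt
  set H := P.hessian y with hH
  set a := y ⬝ᵥ H *ᵥ y with ha
  set b := v ⬝ᵥ H *ᵥ y with hb
  set c := v ⬝ᵥ H *ᵥ v with hc
  have hyy := hom.dotProduct_hessian_mulVec_self y
  rw [← hH, ← ha] at hyy
  have ha0 : 0 ≤ a := by
    rw [hyy]
    have := eval_nonneg_of_coeff_nonneg nonneg fun i => (hy i).le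
    positivity
  have ha' : 0 < a := by
    refine ha0.lt_of_ne' fun h => ?_
    rw [h, mul_zero] at hlt
    exact absurd hlt (sq_nonneg b).not_gt
  have hstab := hP.resolve_left (by
    rintro rfl
    rw [map_zero] at hyy
    simp [hyy] at ha')
  have hcoef : (((d - 1 : ℕ) : ℂ) * d) ≠ 0 := by
    intro h
    have h' : (((d - 1 : ℕ) : ℝ) * d) = 0 := by exact_mod_cast h
    rw [← mul_assoc, h', zero_mul] at hyy
    exact ha'.ne' hyy
  set δ : ℝ := √(c * a - b ^ 2) with hδ
  have hδ0 : 0 < δ := Real.sqrt_pos.2 (sub_pos.2 hlt)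
  have hδ2 : δ ^ 2 = c * a - b ^ 2 := Real.sq_sqrt (sub_pos.2 hlt).le
  -- If the inequality fails, the quadratic `c + 2 b t + a t²` has negative discriminant; `t` is its
  -- root in the upper half plane. Up to the factor `d (d - 1)`, this quadratic is `P` on the line
  -- `v + t y`, so `z` contradicts stability.
  set t : ℂ := ⟨-b / a, δ / a⟩ with ht
  set z : σ → ℂ := fun i => (v i : ℂ) + t * (y i : ℂ) with hz
  have hzim : ∀ j, 0 < (z j).im := by
    intro j
    simp only [hz, ht, Complex.add_im, Complex.mul_im, Complex.ofReal_im, Complex.ofReal_re]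
    have := mul_pos (div_pos hδ0 ha') (hy j)
    linarith
  refine hstab z hzim ?_
  have hconst : ∀ i j, aeval z (pderiv i (pderiv j P)) = ((H i j : ℝ) : ℂ) := by
    intro i j
    have h0 : (pderiv i (pderiv j P)).IsHomogeneous 0 := by
      have := (hom.pderiv (i := j)).pderiv (i := i)
      rwa [show d - 1 - 1 = 0 by omega] at this
    rw [← totalDegree_zero_iff_isHomogeneous, totalDegree_eq_zero_iff_eq_C] at h0
    rw [hH, hessian_apply, h0]
    simp
  have hquad : ∑ i, ∑ j, z i * (z j * ((H i j : ℝ) : ℂ)) =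
      (((d - 1 : ℕ) : ℂ) * d) * aeval z P := by
    rw [mul_assoc, ← hom.sum_mul_aeval_pderiv z, Finset.mul_sum]
    refine Finset.sum_congr rfl fun i _ => ?_
    rw [mul_left_comm, ← (hom.pderiv (i := i)).sum_mul_aeval_pderiv z, Finset.mul_sum]
    refine Finset.sum_congr rfl fun j _ => ?_
    rw [pderiv_comm, hconst]
  have hexp : ∑ i, ∑ j, z i * (z j * ((H i j : ℝ) : ℂ)) = c + 2 * b * t + a * t ^ 2 := by
    have hb' : b = y ⬝ᵥ H *ᵥ v := by
      rw [hb, dotProduct_mulVec y, ← mulVec_transpose, (isSymm_hessian P y).eq, dotProduct_comm]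
    have e : ∀ i j, z i * (z j * ((H i j : ℝ) : ℂ)) =
        ((v i * (H i j * v j) : ℝ) : ℂ) + t * ((v i * (H i j * y j) : ℝ) : ℂ) +
        t * ((y i * (H i j * v j) : ℝ) : ℂ) + t ^ 2 * ((y i * (H i j * y j) : ℝ) : ℂ) := by
      intro i j
      simp only [hz]
      push_cast
      ring
    simp_rw [e, Finset.sum_add_distrib, ← Finset.mul_sum, ← Complex.ofReal_sum,
      ← Finset.mul_sum]
    change ((v ⬝ᵥ H *ᵥ v : ℝ) : ℂ) + t * ((v ⬝ᵥ H *ᵥ y : ℝ) : ℂ) +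
      t * ((y ⬝ᵥ H *ᵥ v : ℝ) : ℂ) + t ^ 2 * ((y ⬝ᵥ H *ᵥ y : ℝ) : ℂ) = _
    rw [← hb', ← hb, ← hc, ← ha]
    ring
  have hroot : (c : ℂ) + 2 * b * t + a * t ^ 2 = 0 := by
    have hne := ha'.ne'
    apply Complex.ext
    · simp [ht, sq]
      field_simp
      linear_combination -hδ2
    · simp [ht, sq]
      field_simp
      ring
  rw [hexp, hroot, eq_comm, mul_eq_zero] at hquad
  exact hquad.resolve_left hcoef

open Matrix in
/-- The trickle-down inequality: hyperbolicity of the Hessians of all partial derivatives gives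
`A ≤ A²` for the normalized Hessian `A`. -/
theorem MvPolynomial.IsHomogeneous.dotProduct_hessian_le {σ : Type*} [Fintype σ]
    {P : MvPolynomial σ ℝ} {d : ℕ} (hd : 2 ≤ d) (hom : P.IsHomogeneous (d + 1))
    (nonneg : ∀ a, 0 ≤ P.coeff a) {y : σ → ℝ} (hy : ∀ i, 0 < y i) (v : σ → ℝ)
    (hderiv : ∀ l, (v ⬝ᵥ (pderiv l P).hessian y *ᵥ v) * (y ⬝ᵥ (pderiv l P).hessian y *ᵥ y) ≤
      (v ⬝ᵥ (pderiv l P).hessian y *ᵥ y) ^ 2) :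
    v ⬝ᵥ P.hessian y *ᵥ v ≤
      ∑ l, y l * ((P.hessian y *ᵥ v) l ^ 2 / (P.hessian y *ᵥ y) l) := by
  set H := P.hessian y with hH
  have hd1 : (0 : ℝ) < (d - 1 : ℕ) := by
    exact_mod_cast (by omega : 0 < d - 1)
  -- By Euler's identity, contracting the third derivatives with `y` gives `(d - 1) H`. This turns
  -- each `hderiv l` into a bound by `(H v)_l² / (H y)_l`, and the average of the left sides with
  -- weights `y l` into `v ⬝ H v`.
  have hHl : ∀ l i, ((pderiv l P).hessian y *ᵥ y) i = (d - 1 : ℕ) * H l i := by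
    intro l i
    have h1 : (pderiv l P).IsHomogeneous d := hom.pderiv
    rw [h1.hessian_mulVec_self, hH, hessian_apply, pderiv_comm]
  have hdot : ∀ w l, w ⬝ᵥ (pderiv l P).hessian y *ᵥ y = (d - 1 : ℕ) * (H *ᵥ w) l := by
    intro w l
    rw [show (H *ᵥ w) l = ∑ i, H l i * w i from rfl, dotProduct, Finset.mul_sum]
    exact Finset.sum_congr rfl fun i _ => by rw [hHl]; ring
  have hn2 : ∀ l i j, 0 ≤ (pderiv l P).hessian y i j := fun l i j =>
    eval_nonneg_of_coeff_nonneg (coeff_pderiv_nonneg (coeff_pderiv_nonneg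
      (coeff_pderiv_nonneg nonneg l) j) i) fun i => (hy i).le
  have hHn : ∀ i j, 0 ≤ H i j := fun i j =>
    eval_nonneg_of_coeff_nonneg (coeff_pderiv_nonneg (coeff_pderiv_nonneg nonneg j) i)
      fun i => (hy i).le
  have hterm : ∀ l, v ⬝ᵥ (pderiv l P).hessian y *ᵥ v ≤
      (d - 1 : ℕ) * ((H *ᵥ v) l ^ 2 / (H *ᵥ y) l) := by
    intro l
    have hr0 : 0 ≤ (H *ᵥ y) l := Finset.sum_nonneg fun j _ => mul_nonneg (hHn l j) (hy j).le
    rcases hr0.eq_or_lt with h | h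
    · have hz : ∀ i j, (pderiv l P).hessian y i j = 0 := by
        intro i j
        have h1 : (H l i) = 0 := by
          have := (Finset.sum_eq_zero_iff_of_nonneg
            (fun j _ => mul_nonneg (hHn l j) (hy j).le)).1 h.symm i (Finset.mem_univ _)
          exact (mul_eq_zero.1 this).resolve_right (hy i).ne'
        have h2 := hHl l i
        rw [h1, mul_zero] at h2
        have := (Finset.sum_eq_zero_iff_of_nonneg
            (fun j _ => mul_nonneg (hn2 l i j) (hy j).le)).1 h2 j (Finset.mem_univ _)
        exact (mul_eq_zero.1 this).resolve_right (hy j).ne'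
      have : (pderiv l P).hessian y = 0 := by ext i j; exact hz i j
      rw [this, ← h]
      simp
    · have := hderiv l
      rw [hdot, hdot] at this
      rw [← mul_div_assoc, le_div_iff₀ h]
      nlinarith
  have hsum : ∑ l, y l * (v ⬝ᵥ (pderiv l P).hessian y *ᵥ v) =
      (d - 1 : ℕ) * (v ⬝ᵥ H *ᵥ v) := by
    have h3 : ∀ i j, ∑ l, y l * (pderiv l P).hessian y i j = (d - 1 : ℕ) * H i j := by
      intro i j
      have h1 : (pderiv i (pderiv j P)).IsHomogeneous (d - 1) :=
        (hom.pderiv (i := j)).pderiv (i := i)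
      rw [hH, hessian_apply, ← h1.sum_mul_eval_pderiv]
      refine Finset.sum_congr rfl fun l _ => ?_
      rw [hessian_apply, pderiv_comm j l, pderiv_comm i l]
    simp only [dotProduct, mulVec, Finset.mul_sum]
    rw [Finset.sum_comm]
    refine Finset.sum_congr rfl fun i _ => ?_
    rw [Finset.sum_comm]
    refine Finset.sum_congr rfl fun j _ => ?_
    rw [show ((d - 1 : ℕ) : ℝ) * (v i * (H i j * v j)) = v i * v j * ((d - 1 : ℕ) * H i j) by
      ring, ← h3, Finset.mul_sum]
    exact Finset.sum_congr rfl fun l _ => by ring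
  refine le_of_mul_le_mul_left ?_ hd1
  rw [← hsum, Finset.mul_sum]
  refine Finset.sum_le_sum fun l _ => ?_
  rw [mul_left_comm]
  exact mul_le_mul_of_nonneg_left (hterm l) (hy l).le

/-- In an M-convex set of vectors of degree at least two, any two coordinates in the support
are joined by a path of length at most two. -/
theorem IsMConvex.exists_common_neighbor {σ : Type*} {S : Set (σ →₀ ℕ)} (hS : IsMConvex S)
    {d : ℕ} (hd : 2 ≤ d) (hdeg : ∀ a ∈ S, a.degree = d) {i j : σ}
    (hi : ∃ a ∈ S, a i ≠ 0) (hj : ∃ a ∈ S, a j ≠ 0) :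
    ∃ l, (i = l ∨ ∃ a ∈ S, Finsupp.single i 1 + Finsupp.single l 1 ≤ a) ∧
      (l = j ∨ ∃ a ∈ S, Finsupp.single l 1 + Finsupp.single j 1 ≤ a) := by
  classical
  obtain ⟨a, ha, hai⟩ := hi
  obtain ⟨b, hb, hbj⟩ := hj
  by_cases hij : i = j
  · exact ⟨i, Or.inl rfl, Or.inl hij⟩
  have pair : ∀ (k l : σ) (c : σ →₀ ℕ), k ≠ l → c k ≠ 0 → c l ≠ 0 →
      Finsupp.single k 1 + Finsupp.single l 1 ≤ c := by
    intro k l c hkl hk hl x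
    simp only [Finsupp.add_apply, Finsupp.single_apply]
    grind
  by_cases haj : a j = 0
  swap
  · exact ⟨j, Or.inr ⟨a, ha, pair i j a hij hai haj⟩, Or.inl rfl⟩
  -- If `l ≠ i`, the vector `a - e_l + e_j` contains both `i` and `j`. If `l = i`, any `m` in the
  -- support of `b - e_j`, nonempty by `2 ≤ d`, meets `i` in `b - e_j + e_i` and `j` in `b`.
  obtain ⟨l, hl, hl1, hl2⟩ := hS b hb a ha j (by omega)
  by_cases hli : l = i
  · subst hli
    set c := b - Finsupp.single j 1 with hc
    have hcb : c + Finsupp.single j 1 = b :=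
      tsub_add_cancel_of_le (Finsupp.single_le_iff.2 (Nat.one_le_iff_ne_zero.2 hbj))
    have hc0 : c ≠ 0 := by
      intro h0
      have := hdeg b hb
      rw [← hcb, h0, zero_add, Finsupp.degree_single] at this
      omega
    obtain ⟨m, hm⟩ := Finsupp.ne_iff.1 hc0
    have hmc : Finsupp.single m 1 ≤ c :=
      Finsupp.single_le_iff.2 (Nat.one_le_iff_ne_zero.2 hm)
    refine ⟨m, Or.inr ⟨_, hl1, ?_⟩, Or.inr ⟨b, hb, ?_⟩⟩
    · rw [add_comm]
      exact add_le_add_left hmc _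
    · rw [← hcb]
      exact add_le_add_left hmc _
  · refine ⟨j, Or.inr ⟨_, hl2, pair i j _ hij ?_ ?_⟩, Or.inl rfl⟩
    · simp [Finsupp.single_apply, hli, hai]
    · simp

theorem MvPolynomial.hessian_ne_zero_of_le {σ : Type*} {P : MvPolynomial σ ℝ}
    (nonneg : ∀ a, 0 ≤ P.coeff a) {y : σ → ℝ} (hy : ∀ i, 0 < y i) {i j : σ} {a : σ →₀ ℕ}
    (ha : a ∈ P.support) (hle : Finsupp.single i 1 + Finsupp.single j 1 ≤ a) :
    P.hessian y i j ≠ 0 := by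
  have hne : pderiv i (pderiv j P) ≠ 0 := by
    intro h0
    have hsub : a - (Finsupp.single i 1 + Finsupp.single j 1) + Finsupp.single i 1 +
        Finsupp.single j 1 = a := by
      rw [add_assoc, tsub_add_cancel_of_le hle]
    have h1 := coeff_pderiv (i := i) (pderiv j P) (a - (Finsupp.single i 1 + Finsupp.single j 1))
    rw [h0, coeff_pderiv, hsub, coeff_zero, eq_comm, mul_eq_zero, mul_eq_zero] at h1
    rcases h1 with (h1 | h1) | h1
    · exact mem_support_iff.1 ha h1
    · exact absurd h1 (by positivity)
    · exact absurd h1 (by positivity)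
  exact (eval_pos_of_coeff_nonneg
    (coeff_pderiv_nonneg (coeff_pderiv_nonneg nonneg j) i) hne hy).ne'

open Matrix in
/-- The Hessian of a Lorentzian form at a positive point satisfies the reverse Cauchy–Schwarz
inequality. -/
theorem IsLorentzianOfDegree.hessian_mul_le_sq {σ : Type*} [Fintype σ] {d : ℕ}
    {P : MvPolynomial σ ℝ} (hP : IsLorentzianOfDegree d P) {y : σ → ℝ} (hy : ∀ i, 0 < y i)
    (v : σ → ℝ) :
    (v ⬝ᵥ P.hessian y *ᵥ v) * (y ⬝ᵥ P.hessian y *ᵥ y) ≤ (v ⬝ᵥ P.hessian y *ᵥ y) ^ 2 := by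
  induction hP generalizing v with
  | low hd hom nonneg stable => exact stable.hessian_mul_le_sq hd hom nonneg hy v
  | @high d P hd hom supp deriv ih =>
    have nonneg := (IsLorentzianOfDegree.high hd hom supp deriv).coeff_nonneg
    have hHn : ∀ i j, 0 ≤ P.hessian y i j := fun i j =>
      eval_nonneg_of_coeff_nonneg (coeff_pderiv_nonneg (coeff_pderiv_nonneg nonneg j) i)
        fun i => (hy i).le
    refine (isSymm_hessian P y).mul_le_sq_of_nonpos ?_ ?_ v
    · exact Finset.sum_nonneg fun i _ => mul_nonneg (hy i).le
        (Finset.sum_nonneg fun j _ => mul_nonneg (hHn i j) (hy j).le)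
    · refine (isSymm_hessian P y).dotProduct_mulVec_nonpos_of_connected hHn hy
        (fun w => hom.dotProduct_hessian_le hd nonneg hy w fun l => ih l w) ?_
      have hact : ∀ i, (P.hessian y *ᵥ y) i ≠ 0 → ∃ a ∈ (P.support : Set (σ →₀ ℕ)), a i ≠ 0 := by
        intro i hi
        refine pderiv_ne_zero_iff.1 fun h0 => hi ?_
        rw [hom.hessian_mulVec_self, h0, map_zero, mul_zero]
      intro i j hi hj
      have hdeg : ∀ a ∈ (P.support : Set (σ →₀ ℕ)), a.degree = d + 1 := by
        intro a ha
        by_contra hne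
        exact mem_support_iff.1 ha (hom.coeff_eq_zero hne)
      obtain ⟨l, h1, h2⟩ := supp.exists_common_neighbor (by omega) hdeg (hact i hi) (hact j hj)
      exact ⟨l, h1.imp_right fun ⟨a, ha, hle⟩ => hessian_ne_zero_of_le nonneg hy ha hle,
        h2.imp_right fun ⟨a, ha, hle⟩ => hessian_ne_zero_of_le nonneg hy ha hle⟩

/-! ### The univariate capacity inequality -/

/-- A log-concave sequence without internal zeros is dominated by a geometric sequence. -/
theorem le_geom_of_log_concave {b : ℕ → ℝ} {N : ℕ} {r : ℝ} (hr : 0 < r) (h0 : ∀ m, 0 ≤ b m)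
    (hlc : ∀ m, m + 2 ≤ N → b m * b (m + 2) ≤ b (m + 1) ^ 2)
    (hz : ∀ m, m + 1 ≤ N → b m = 0 → b (m + 1) = 0) (h1 : 1 ≤ N → b 1 ≤ r * b 0)
    {m : ℕ} (hm : m ≤ N) : b m ≤ r ^ m * b 0 := by
  have hstep : ∀ m, m + 1 ≤ N → b (m + 1) ≤ r * b m := by
    intro m
    induction m with
    | zero => exact h1
    | succ m ih =>
      intro hm
      rcases (h0 (m + 1)).eq_or_lt with h | h
      · rw [hz (m + 1) hm h.symm, ← h, mul_zero]
      · have hbm : 0 < b m := (h0 m).lt_of_ne' fun h' => h.ne' (hz m (by omega) h')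
        refine le_of_mul_le_mul_left ?_ hbm
        have := mul_le_mul_of_nonneg_left (ih (by omega)) h.le
        have := hlc m hm
        nlinarith
  induction m with
  | zero => simp
  | succ m ih =>
    calc b (m + 1) ≤ r * b m := hstep m hm
      _ ≤ r * (r ^ m * b 0) := mul_le_mul_of_nonneg_left (ih (by omega)) hr.le
      _ = r ^ (m + 1) * b 0 := by ring

/-- A polynomial bounded below by `C t ^ k`, whose lowest term has degree at least `k`, has
coefficient at least `C` in degree `k`. -/
theorem le_coeff_of_forall_mul_pow_le_of_low {n k : ℕ} (hk : k ≤ n) {c : ℕ → ℝ} {C : ℝ}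
    (hC : ∀ t : ℝ, 0 < t → C * t ^ k ≤ ∑ j ∈ Finset.range (n + 1), c j * t ^ j)
    (hlow : ∀ j < k, c j = 0) : C ≤ c k := by
  obtain ⟨l, rfl⟩ := Nat.exists_eq_add_of_le hk
  have hcont : Continuous fun t : ℝ => ∑ m ∈ Finset.range (l + 1), c (k + m) * t ^ m := by
    fun_prop
  have hlim := (hcont.tendsto 0).mono_left (nhdsWithin_le_nhds (s := Set.Ioi 0))
  have h0 : ∑ m ∈ Finset.range (l + 1), c (k + m) * (0 : ℝ) ^ m = c k := by
    rw [Finset.sum_range_succ']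
    simp
  rw [h0] at hlim
  refine ge_of_tendsto hlim ?_
  filter_upwards [self_mem_nhdsWithin] with t ht
  have ht' : 0 < t := ht
  have := hC t ht'
  rw [add_assoc, Finset.sum_range_add, Finset.sum_eq_zero fun j hj => by
    rw [hlow j (Finset.mem_range.1 hj), zero_mul], zero_add] at this
  refine le_of_mul_le_mul_right (this.trans_eq ?_) (pow_pos ht' k)
  rw [Finset.sum_mul]
  exact Finset.sum_congr rfl fun m _ => by ring

/-- A polynomial bounded below by `C t ^ k`, whose highest term has degree at most `k`, has
coefficient at least `C` in degree `k`. -/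
theorem le_coeff_of_forall_mul_pow_le_of_high {n k : ℕ} (hk : k ≤ n) {c : ℕ → ℝ} {C : ℝ}
    (hC : ∀ t : ℝ, 0 < t → C * t ^ k ≤ ∑ j ∈ Finset.range (n + 1), c j * t ^ j)
    (hhigh : ∀ j, k < j → j ≤ n → c j = 0) : C ≤ c k := by
  -- Substituting `t⁻¹` and multiplying by `t ^ n` reverses the coefficients.
  have := le_coeff_of_forall_mul_pow_le_of_low (n := n) (k := n - k) (c := fun j => c (n - j))
    (C := C) (Nat.sub_le _ _) ?_ ?_
  · simpa [Nat.sub_sub_self hk] using this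
  · intro t ht
    have h := mul_le_mul_of_nonneg_right (hC t⁻¹ (inv_pos.2 ht)) (pow_pos ht n).le
    rw [← Finset.sum_range_reflect]
    rw [Finset.sum_mul] at h
    have e : ∀ j ≤ n, t⁻¹ ^ j * t ^ n = t ^ (n - j) := by
      intro j hj
      rw [pow_sub₀ t ht.ne' hj, inv_pow, mul_comm]
    rw [mul_assoc, e k hk] at h
    refine h.trans_eq (Finset.sum_congr rfl fun j hj => ?_)
    have hj' : j ≤ n := Nat.lt_succ_iff.1 (Finset.mem_range.1 hj)
    rw [mul_assoc, e j hj', show n + 1 - 1 - j = n - j by omega, Nat.sub_sub_self hj']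
  · intro j hj
    exact hhigh _ (by omega) (by omega)

/-- The univariate capacity inequality for ultra log-concave coefficient sequences without
internal zeros. -/
theorem mul_le_coeff_of_ultra_log_concave {n k : ℕ} (hk : k ≤ n) {c : ℕ → ℝ} {C : ℝ}
    (hnn : ∀ j, 0 ≤ c j)
    (hulc : ∀ j, j + 2 ≤ n → ((n - j : ℕ) : ℝ) * (j + 2 : ℕ) * (c j * c (j + 2)) ≤
      ((n - (j + 1) : ℕ) : ℝ) * (j + 1 : ℕ) * c (j + 1) ^ 2)
    (hgap : ∀ a j b, a < j → j < b → b ≤ n → 0 < c a → 0 < c b → 0 < c j)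
    (hC : ∀ t : ℝ, 0 < t → C * t ^ k ≤ ∑ j ∈ Finset.range (n + 1), c j * t ^ j) :
    C * ((n.choose k : ℝ) * ((k : ℝ) / n) ^ k * (((n : ℝ) - k) / n) ^ (n - k)) ≤ c k := by
  have hkn : (k : ℝ) ≤ n := by exact_mod_cast hk
  have hK : 0 ≤ (n.choose k : ℝ) * ((k : ℝ) / n) ^ k * (((n : ℝ) - k) / n) ^ (n - k) := by
    have : 0 ≤ ((n : ℝ) - k) / n := div_nonneg (sub_nonneg.2 hkn) (by positivity)
    positivity
  rcases (hnn k).eq_or_lt with hck | hck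
  · have hC0 : C ≤ 0 := by
      rw [hck]
      by_cases hlow : ∀ j < k, c j = 0
      · exact le_coeff_of_forall_mul_pow_le_of_low hk hC hlow
      · push Not at hlow
        obtain ⟨a, hak, ha⟩ := hlow
        refine le_coeff_of_forall_mul_pow_le_of_high hk hC fun j hkj hj => ?_
        by_contra hne
        exact (hgap a k j hak hkj hj ((hnn a).lt_of_ne' ha) ((hnn j).lt_of_ne' hne)).ne hck
    rw [← hck]
    exact mul_nonpos_of_nonpos_of_nonneg hC0 hK
  rcases Nat.eq_zero_or_pos k with rfl | hk0
  · have : C ≤ c 0 := le_coeff_of_forall_mul_pow_le_of_low hk hC (by simp)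
    rcases Nat.eq_zero_or_pos n with rfl | hn0
    · simpa using this
    · have : (n : ℝ) ≠ 0 := by positivity
      simpa [this]
  rcases hk.eq_or_lt with rfl | hkn'
  · have : C ≤ c k := le_coeff_of_forall_mul_pow_le_of_high hk hC (by omega)
    have hk' : (k : ℝ) ≠ 0 := by positivity
    simpa [hk']
  set a : ℕ → ℝ := fun j => c j / n.choose j with ha
  have hch : ∀ j ≤ n, (0 : ℝ) < n.choose j := fun j hj => by exact_mod_cast Nat.choose_pos hj
  have hann : ∀ j, 0 ≤ a j := fun j => div_nonneg (hnn j) (by positivity)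
  have hca : ∀ j ≤ n, c j = a j * n.choose j := fun j hj => (div_mul_cancel₀ _ (hch j hj).ne').symm
  have hapos : ∀ j ≤ n, (0 < a j ↔ 0 < c j) := fun j hj => by
    rw [hca j hj, mul_pos_iff_of_pos_right (hch j hj)]
  have hak : 0 < a k := (hapos k hk).2 hck
  have hlc : ∀ j, j + 2 ≤ n → a j * a (j + 2) ≤ a (j + 1) ^ 2 := by
    intro j hj
    have h := hulc j hj
    have e1 : ((n.choose (j + 1) : ℝ)) * (j + 1 : ℕ) = n.choose j * (n - j : ℕ) := by
      exact_mod_cast Nat.choose_succ_right_eq n j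
    have e2 : ((n.choose (j + 2) : ℝ)) * (j + 2 : ℕ) = n.choose (j + 1) * (n - (j + 1) : ℕ) := by
      exact_mod_cast Nat.choose_succ_right_eq n (j + 1)
    rw [hca j (by omega), hca (j + 1) (by omega), hca (j + 2) hj] at h
    have hpos : (0 : ℝ) < (n - (j + 1) : ℕ) * (j + 1 : ℕ) * (n.choose (j + 1)) ^ 2 := by
      have := hch (j + 1) (by omega)
      have : (0 : ℝ) < (n - (j + 1) : ℕ) := by exact_mod_cast (by omega : 0 < n - (j + 1))
      positivity
    refine le_of_mul_le_mul_left ?_ hpos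
    calc ((n - (j + 1) : ℕ) : ℝ) * (j + 1 : ℕ) * (n.choose (j + 1)) ^ 2 * (a j * a (j + 2))
        = (n.choose (j + 1) * (j + 1 : ℕ)) * (n.choose (j + 1) * (n - (j + 1) : ℕ)) *
            (a j * a (j + 2)) := by ring
      _ = ((n - j : ℕ) : ℝ) * (j + 2 : ℕ) *
            (a j * n.choose j * (a (j + 2) * n.choose (j + 2))) := by rw [e1, ← e2]; ring
      _ ≤ _ := h
      _ = _ := by ring
  -- The ratio of a geometric sequence supporting `a` at `k`: it must lie between `a (k + 1) / a k`
  -- and `a k / a (k - 1)`. If `a (k - 1) = 0` there is no upper constraint, and adding `1` ensures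
  -- positivity even when `a (k + 1) = 0`.
  obtain ⟨r, hr, hr1, hr2⟩ : ∃ r : ℝ, 0 < r ∧ a (k + 1) ≤ r * a k ∧ a (k - 1) ≤ r⁻¹ * a k := by
    rcases (hann (k - 1)).eq_or_lt with h | h
    · have := div_nonneg (hann (k + 1)) hak.le
      refine ⟨a (k + 1) / a k + 1, by positivity, ?_, ?_⟩
      · rw [add_mul, div_mul_cancel₀ _ hak.ne']
        linarith
      · rw [← h]
        positivity
    · refine ⟨a k / a (k - 1), by positivity, ?_, ?_⟩
      · have := hlc (k - 1) (by omega)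
        rw [show k - 1 + 2 = k + 1 by omega, show k - 1 + 1 = k by omega] at this
        rw [div_mul_eq_mul_div, le_div_iff₀ h]
        linarith
      · rw [inv_div, div_mul_cancel₀ _ hak.ne']
  have hdom : ∀ j ≤ n, a j * r ^ k ≤ a k * r ^ j := by
    intro j hj
    rcases le_total k j with hkj | hkj
    · obtain ⟨m, rfl⟩ := Nat.exists_eq_add_of_le hkj
      have := le_geom_of_log_concave (b := fun m => a (k + m)) (N := n - k) hr
        (fun m => hann _) (fun m hm => hlc (k + m) (by omega)) ?_ (fun _ => hr1) (m := m)
        (by omega)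
      · rw [pow_add]
        simp only [add_zero] at this
        nlinarith [mul_le_mul_of_nonneg_right this (pow_pos hr k).le]
      · intro m hm h0
        by_contra hne
        have h1 := (hann _).lt_of_ne' hne
        rcases Nat.eq_zero_or_pos m with rfl | hm0
        · exact hak.ne' h0
        · exact ((hapos (k + m) (by omega)).2 (hgap k (k + m) (k + (m + 1)) (by omega) (by omega)
            (by omega) hck ((hapos _ (by omega)).1 h1))).ne' h0
    · obtain ⟨m, hm⟩ := Nat.exists_eq_add_of_le hkj
      have := le_geom_of_log_concave (b := fun m => a (k - m)) (N := k) (inv_pos.2 hr)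
        (fun m => hann _) ?_ ?_ (fun _ => hr2) (m := m) (by omega)
      · simp only [tsub_zero] at this
        rw [show k - m = j by omega] at this
        have h2 := mul_le_mul_of_nonneg_right this (pow_pos hr k).le
        refine h2.trans_eq ?_
        rw [inv_pow, hm, pow_add]
        field_simp
      · intro m hm
        have := hlc (k - (m + 2)) (by omega)
        rw [show k - (m + 2) + 2 = k - m by omega, show k - (m + 2) + 1 = k - (m + 1) by omega]
          at this
        linarith
      · intro m hm h0
        by_contra hne
        have h1 := (hann _).lt_of_ne' hne
        rcases Nat.eq_zero_or_pos m with rfl | hm0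
        · exact hak.ne' h0
        · exact ((hapos (k - m) (by omega)).2 (hgap (k - (m + 1)) (k - m) k (by omega) (by omega)
            (by omega) ((hapos _ (by omega)).1 h1) hck)).ne' h0
  have hnk : (0 : ℝ) < n - k := by
    rw [sub_pos]; exact_mod_cast hkn'
  have hn0 : (0 : ℝ) < n := by
    have : (0 : ℝ) ≤ k := by positivity
    linarith
  -- The minimizer of `(1 + s)^n / s^k`; it is positive and finite since `k = 0` and `k = n` are
  -- already settled.
  set s : ℝ := k / (n - k) with hs
  have hs0 : 0 < s := by positivity
  have hmain : C * s ^ k ≤ a k * (s + 1) ^ n := by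
    have h := mul_le_mul_of_nonneg_right (hC (s / r) (by positivity)) (pow_pos hr k).le
    have h1 : C * (s / r) ^ k * r ^ k = C * s ^ k := by
      rw [div_pow]; field_simp
    rw [h1] at h
    refine h.trans ?_
    rw [Finset.sum_mul, add_pow, Finset.mul_sum]
    refine Finset.sum_le_sum fun j hj => ?_
    have hj' : j ≤ n := Nat.lt_succ_iff.1 (Finset.mem_range.1 hj)
    rw [hca j hj', one_pow, mul_one]
    have := mul_le_mul_of_nonneg_right (hdom j hj')
      (by positivity : 0 ≤ (n.choose j : ℝ) * (s / r) ^ j)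
    calc a j * n.choose j * (s / r) ^ j * r ^ k
        = a j * r ^ k * (n.choose j * (s / r) ^ j) := by ring
      _ ≤ _ := this
      _ = a k * (s ^ j * n.choose j) := by rw [div_pow]; field_simp
  have hs1 : s + 1 = n / (n - k) := by rw [hs]; field_simp; ring
  have e1 : (k : ℝ) / n = s / (s + 1) := by rw [hs1, hs]; field_simp
  have e2 : ((n : ℝ) - k) / n = 1 / (s + 1) := by rw [hs1]; field_simp
  have e3 : ((k : ℝ) / n) ^ k * (((n : ℝ) - k) / n) ^ (n - k) = s ^ k / (s + 1) ^ n := by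
    rw [e1, e2, div_pow s (s + 1), div_pow 1 (s + 1), one_pow, div_mul_div_comm, mul_one,
      ← pow_add, Nat.add_sub_cancel' hk]
  rw [mul_assoc, e3, hca k hk, mul_left_comm, mul_comm (a k)]
  refine mul_le_mul_of_nonneg_left ?_ (hch k hk).le
  rw [← mul_div_assoc, div_le_iff₀ (by positivity)]
  exact hmain

/-! ### Specialization to one variable -/

/-- The univariate polynomial obtained by specializing all variables but the `i`-th. -/
noncomputable def MvPolynomial.specialize {m : ℕ} (i : Fin (m + 1)) (y : Fin m → ℝ)
    (P : MvPolynomial (Fin (m + 1)) ℝ) : Polynomial ℝ :=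
  aeval (i.insertNth (α := fun _ => Polynomial ℝ) Polynomial.X fun j => Polynomial.C (y j)) P

theorem MvPolynomial.eval_specialize {m : ℕ} (i : Fin (m + 1)) (y : Fin m → ℝ)
    (P : MvPolynomial (Fin (m + 1)) ℝ) (t : ℝ) :
    (specialize i y P).eval t = eval (i.insertNth (α := fun _ => ℝ) t y) P := by
  unfold specialize
  induction P using MvPolynomial.induction_on with
  | C a => simp
  | add p q hp hq => simp [hp, hq]
  | mul_X p j hp =>
    rw [map_mul, map_mul, Polynomial.eval_mul, hp, aeval_X, eval_X]
    congr 1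
    refine Fin.succAboveCases i ?_ (fun j => ?_) j <;> simp

theorem MvPolynomial.derivative_specialize {m : ℕ} (i : Fin (m + 1)) (y : Fin m → ℝ)
    (P : MvPolynomial (Fin (m + 1)) ℝ) :
    Polynomial.derivative (specialize i y P) = specialize i y (pderiv i P) := by
  unfold specialize
  induction P using MvPolynomial.induction_on with
  | C a => simp
  | add p q hp hq => simp [hp, hq]
  | mul_X p j hp =>
    rw [map_mul (aeval _), pderiv_mul, map_add, map_mul (aeval _), map_mul (aeval _),
      Polynomial.derivative_mul, hp, aeval_X]
    congr 2
    refine Fin.succAboveCases i ?_ (fun j => ?_) j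
    · simp
    · simp [pderiv_X_of_ne (Fin.succAbove_ne i j)]

theorem MvPolynomial.iterate_derivative_specialize {m : ℕ} (i : Fin (m + 1)) (y : Fin m → ℝ)
    (P : MvPolynomial (Fin (m + 1)) ℝ) (k : ℕ) :
    Polynomial.derivative^[k] (specialize i y P) = specialize i y ((pderiv i)^[k] P) := by
  induction k with
  | zero => rfl
  | succ k ih => rw [Function.iterate_succ_apply', ih, derivative_specialize,
      Function.iterate_succ_apply']

theorem MvPolynomial.eval_insertNth_zero_iterate_pderiv {m : ℕ} (i : Fin (m + 1))
    (y : Fin m → ℝ) (P : MvPolynomial (Fin (m + 1)) ℝ) (k : ℕ) :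
    eval (i.insertNth (α := fun _ => ℝ) 0 y) ((pderiv i)^[k] P) =
      k.factorial * (specialize i y P).coeff k := by
  rw [← eval_specialize, ← iterate_derivative_specialize, ← Polynomial.coeff_zero_eq_eval_zero,
    Polynomial.coeff_iterate_derivative, zero_add, Nat.descFactorial_self, nsmul_eq_mul]

theorem eval_derivRestrict {m : ℕ} (i : Fin (m + 1)) (k : ℕ)
    (P : MvPolynomial (Fin (m + 1)) ℝ) (y : Fin m → ℝ) :
    eval y (derivRestrict i k P) = k.factorial * (specialize i y P).coeff k := by
  rw [← eval_insertNth_zero_iterate_pderiv]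
  unfold derivRestrict
  generalize (pderiv i)^[k] P = Q
  induction Q using MvPolynomial.induction_on with
  | C a => simp
  | add p q hp hq => rw [map_add, map_add, map_add, hp, hq]
  | mul_X p j hp =>
    rw [map_mul, map_mul, map_mul, hp, aeval_X, eval_X]
    congr 1
    refine Fin.succAboveCases i ?_ (fun j => ?_) j <;> simp

theorem MvPolynomial.coeff_specialize {m : ℕ} (i : Fin (m + 1)) (y : Fin m → ℝ)
    (P : MvPolynomial (Fin (m + 1)) ℝ) (k : ℕ) :
    (specialize i y P).coeff k =
      ∑ a ∈ P.support with a i = k, P.coeff a * ∏ j, y j ^ a (i.succAbove j) := by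
  unfold specialize
  rw [aeval_def, eval₂_eq', Polynomial.finsetSum_coeff, Finset.sum_filter]
  refine Finset.sum_congr rfl fun a _ => ?_
  rw [Fin.prod_univ_succAbove _ i]
  simp only [Fin.insertNth_apply_same, Fin.insertNth_apply_succAbove, ← Polynomial.C_pow,
    ← map_prod]
  rw [Polynomial.algebraMap_eq, mul_comm (Polynomial.X ^ _), ← mul_assoc, ← Polynomial.C_mul,
    Polynomial.coeff_C_mul_X_pow]
  simp only [eq_comm]

theorem MvPolynomial.coeff_specialize_nonneg {m : ℕ} (i : Fin (m + 1)) {y : Fin m → ℝ}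
    (hy : ∀ j, 0 < y j) {P : MvPolynomial (Fin (m + 1)) ℝ} (hP : ∀ a, 0 ≤ P.coeff a) (k : ℕ) :
    0 ≤ (specialize i y P).coeff k := by
  rw [coeff_specialize]
  exact Finset.sum_nonneg fun a _ =>
    mul_nonneg (hP a) (Finset.prod_nonneg fun j _ => pow_nonneg (hy j).le _)

theorem MvPolynomial.coeff_specialize_pos_iff {m : ℕ} (i : Fin (m + 1)) {y : Fin m → ℝ}
    (hy : ∀ j, 0 < y j) {P : MvPolynomial (Fin (m + 1)) ℝ} (hP : ∀ a, 0 ≤ P.coeff a) (k : ℕ) :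
    0 < (specialize i y P).coeff k ↔ ∃ a ∈ P.support, a i = k := by
  rw [coeff_specialize]
  constructor
  · intro h
    obtain ⟨a, ha, -⟩ := Finset.exists_ne_zero_of_sum_ne_zero h.ne'
    exact ⟨a, (Finset.mem_filter.1 ha).1, (Finset.mem_filter.1 ha).2⟩
  · rintro ⟨a, ha, hk⟩
    refine Finset.sum_pos (fun b hb => ?_) ⟨a, Finset.mem_filter.2 ⟨ha, hk⟩⟩
    exact mul_pos ((hP b).lt_of_ne' (mem_support_iff.1 (Finset.mem_filter.1 hb).1))
      (Finset.prod_pos fun j _ => pow_pos (hy j) _)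

theorem MvPolynomial.IsHomogeneous.eval_insertNth {m : ℕ} (i : Fin (m + 1)) (y : Fin m → ℝ)
    {P : MvPolynomial (Fin (m + 1)) ℝ} {n : ℕ} (hP : P.IsHomogeneous n) (t : ℝ) :
    eval (i.insertNth (α := fun _ => ℝ) t y) P =
      ∑ j ∈ Finset.range (n + 1), (specialize i y P).coeff j * t ^ j := by
  rw [← eval_specialize]
  refine Polynomial.eval_eq_sum_range' (Nat.lt_succ_iff.2 ?_) t
  refine Polynomial.natDegree_le_iff_coeff_eq_zero.2 fun k hk => ?_
  rw [coeff_specialize]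
  refine Finset.sum_eq_zero fun a ha => absurd hk ?_
  obtain ⟨hsupp, rfl⟩ := Finset.mem_filter.1 ha
  have : a.degree = n := by
    by_contra hne
    exact mem_support_iff.1 hsupp (hP.coeff_eq_zero hne)
  rw [← this, not_lt]
  exact Finsupp.le_degree i a

/-! ### Ultra log-concavity and absence of internal zeros -/

theorem IsLorentzianOfDegree.iterate_pderiv {σ : Type*} {P : MvPolynomial σ ℝ} (i : σ)
    {k d : ℕ} (hd : 2 ≤ d) (hP : IsLorentzianOfDegree (d + k) P) :
    IsLorentzianOfDegree d ((pderiv i)^[k] P) := by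
  induction k generalizing P with
  | zero => exact hP
  | succ k ih =>
    rw [Function.iterate_succ_apply]
    refine ih ?_
    rw [← add_assoc] at hP
    generalize he : d + k + 1 = e at hP
    cases hP with
    | low h => omega
    | high h1 hom supp deriv =>
      obtain rfl := Nat.succ_injective he
      exact deriv i

open Matrix in
/-- The Newton-type inequality between consecutive partial derivatives of a Lorentzian form. -/
theorem IsLorentzianOfDegree.eval_mul_eval_pderiv_pderiv_le {σ : Type*} [Fintype σ] {d : ℕ}
    {P : MvPolynomial σ ℝ} (hP : IsLorentzianOfDegree d P) (hd : 2 ≤ d) {x : σ → ℝ}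
    (hx : ∀ i, 0 < x i) (i : σ) :
    d * (eval x P * eval x (pderiv i (pderiv i P))) ≤
      (d - 1 : ℕ) * eval x (pderiv i P) ^ 2 := by
  classical
  -- In the direction `e_i` the quadratic form is `∂_i² P`; Euler's identity evaluates the two
  -- contractions with `x`.
  have h := hP.hessian_mul_le_sq hx (Pi.single i 1)
  rw [hP.isHomogeneous.dotProduct_hessian_mulVec_self] at h
  simp only [single_dotProduct, one_mul, hP.isHomogeneous.hessian_mulVec_self, mulVec_single,
    MulOpposite.op_one, one_smul, Matrix.col_apply, hessian_apply] at h
  have hd1 : (0 : ℝ) < (d - 1 : ℕ) := by exact_mod_cast (by omega : 0 < d - 1)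
  refine le_of_mul_le_mul_left ?_ hd1
  linarith [h]

/-- The Newton-type inequality for `∂_i^j P` holds at `x_i = t > 0` and passes to `t = 0` by
continuity. There the derivatives equal `j! c_j`, `(j+1)! c_(j+1)` and `(j+2)! c_(j+2)`; cancelling
`j!² (j+1)` gives the claim. -/
theorem IsLorentzianOfDegree.coeff_specialize_ultra_log_concave {m : ℕ} (i : Fin (m + 1))
    {y : Fin m → ℝ} (hy : ∀ j, 0 < y j) {P : MvPolynomial (Fin (m + 1)) ℝ} {n : ℕ}
    (hP : IsLorentzianOfDegree n P) (j : ℕ) (hj : j + 2 ≤ n) :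
    ((n - j : ℕ) : ℝ) * (j + 2 : ℕ) *
        ((specialize i y P).coeff j * (specialize i y P).coeff (j + 2)) ≤
      ((n - (j + 1) : ℕ) : ℝ) * (j + 1 : ℕ) * (specialize i y P).coeff (j + 1) ^ 2 := by
  have hQ : IsLorentzianOfDegree (n - j) ((pderiv i)^[j] P) :=
    IsLorentzianOfDegree.iterate_pderiv i (by omega)
      (by rwa [Nat.sub_add_cancel (by omega : j ≤ n)])
  set Q := (pderiv i)^[j] P with hQdef
  have hpos : ∀ t : ℝ, 0 < t →
      ((n - j : ℕ) : ℝ) * ((specialize i y Q).eval t *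
        (specialize i y (pderiv i (pderiv i Q))).eval t) ≤
      (n - j - 1 : ℕ) * (specialize i y (pderiv i Q)).eval t ^ 2 := by
    intro t ht
    simp only [eval_specialize]
    refine hQ.eval_mul_eval_pderiv_pderiv_le (by omega) (fun l => ?_) i
    refine Fin.succAboveCases i ?_ (fun l => ?_) l
    · simpa using ht
    · simpa using hy l
  have hlim : ((n - j : ℕ) : ℝ) * ((specialize i y Q).eval 0 *
        (specialize i y (pderiv i (pderiv i Q))).eval 0) ≤
      (n - j - 1 : ℕ) * (specialize i y (pderiv i Q)).eval 0 ^ 2 := by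
    have c1 : Continuous fun t : ℝ => ((n - j : ℕ) : ℝ) * ((specialize i y Q).eval t *
        (specialize i y (pderiv i (pderiv i Q))).eval t) := by fun_prop
    have c2 : Continuous fun t : ℝ =>
        ((n - j - 1 : ℕ) : ℝ) * (specialize i y (pderiv i Q)).eval t ^ 2 := by fun_prop
    refine le_of_tendsto_of_tendsto
      ((c1.tendsto 0).mono_left (nhdsWithin_le_nhds (s := Set.Ioi 0)))
      ((c2.tendsto 0).mono_left nhdsWithin_le_nhds) ?_
    filter_upwards [self_mem_nhdsWithin] with t ht using hpos t ht
  have e1 : pderiv i Q = (pderiv i)^[j + 1] P := by rw [Function.iterate_succ_apply']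
  have e2 : pderiv i (pderiv i Q) = (pderiv i)^[j + 2] P := by
    rw [e1, ← Function.iterate_succ_apply' (pderiv i)]
  rw [e2, e1, hQdef, eval_specialize, eval_specialize, eval_specialize,
    eval_insertNth_zero_iterate_pderiv, eval_insertNth_zero_iterate_pderiv,
    eval_insertNth_zero_iterate_pderiv, Nat.factorial_succ (j + 1), Nat.factorial_succ j,
    Nat.sub_sub] at hlim
  push_cast at hlim ⊢
  have hf : (0 : ℝ) < (j.factorial : ℝ) ^ 2 * (j + 1) := by positivity
  refine le_of_mul_le_mul_left ?_ hf
  rw [show (j : ℝ) + 1 + 1 = j + 2 by ring] at hlim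
  linarith

/-- Each exchange of `b` against `a` at `i` lowers `b i` by exactly one, so no intermediate value is
skipped. -/
theorem IsMConvex.exists_apply_eq {σ : Type*} {S : Set (σ →₀ ℕ)} (hS : IsMConvex S) {i : σ}
    {a b : σ →₀ ℕ} (ha : a ∈ S) (hb : b ∈ S) {k : ℕ} (hak : a i ≤ k) (hkb : k ≤ b i) :
    ∃ c ∈ S, c i = k := by
  classical
  generalize hl : b i - k = l
  induction l generalizing b with
  | zero => exact ⟨b, hb, by omega⟩
  | succ l ih =>
    obtain ⟨j, hj, h1, -⟩ := hS b hb a ha i (by omega)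
    have hji : j ≠ i := by rintro rfl; omega
    have hval : (b - Finsupp.single i 1 + Finsupp.single j 1 : σ →₀ ℕ) i = b i - 1 := by
      simp [hji]
    exact ih h1 (by omega) (by omega)

theorem IsLorentzianOfDegree.coeff_specialize_pos {m : ℕ} (i : Fin (m + 1))
    {y : Fin m → ℝ} (hy : ∀ j, 0 < y j) {P : MvPolynomial (Fin (m + 1)) ℝ} {n : ℕ}
    (hP : IsLorentzianOfDegree n P) {a j b : ℕ} (haj : a < j) (hjb : j < b) (hbn : b ≤ n)
    (ha : 0 < (specialize i y P).coeff a) (hb : 0 < (specialize i y P).coeff b) :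
    0 < (specialize i y P).coeff j := by
  have hnn := hP.coeff_nonneg
  have hulc := hP.coeff_specialize_ultra_log_concave i hy
  cases hP with
  | low hd hom nonneg stable =>
    obtain rfl : a = 0 := by omega
    obtain rfl : j = 1 := by omega
    obtain rfl : b = 2 := by omega
    obtain rfl : n = 2 := by omega
    -- M-convexity is not part of the definition in low degree. The only possible gap is `c_1 = 0`
    -- in degree two, where ultra log-concavity would force `c_0 c_2 ≤ 0`.
    refine (coeff_specialize_nonneg i hy hnn 1).lt_of_ne' fun h => ?_
    have := hulc 0 le_rfl
    simp only [zero_add, h] at this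
    norm_num at this
    nlinarith [mul_pos ha hb]
  | high hd hom supp deriv =>
    rw [coeff_specialize_pos_iff i hy hnn] at ha hb ⊢
    obtain ⟨u, hu, rfl⟩ := ha
    obtain ⟨v, hv, rfl⟩ := hb
    exact supp.exists_apply_eq hu hv haj.le hjb.le

/-! ### Capacity and the final inequality -/

theorem capacity_nonneg {σ : Type*} [Fintype σ] (α : σ → ℝ) {P : MvPolynomial σ ℝ}
    (hP : ∀ a, 0 ≤ P.coeff a) : 0 ≤ capacity α P :=
  Real.iInf_nonneg fun x => div_nonneg (eval_nonneg_of_coeff_nonneg hP fun j => (x.2 j).le)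
    (Finset.prod_nonneg fun j _ => Real.rpow_nonneg (x.2 j).le _)

theorem capacity_mul_le_eval {σ : Type*} [Fintype σ] (α : σ → ℝ) {P : MvPolynomial σ ℝ}
    (hP : ∀ a, 0 ≤ P.coeff a) {x : σ → ℝ} (hx : ∀ j, 0 < x j) :
    capacity α P * ∏ j, x j ^ α j ≤ eval x P := by
  rw [← le_div_iff₀ (Finset.prod_pos fun j _ => Real.rpow_pos_of_pos (hx j) _)]
  refine ciInf_le (f := fun x : {x : σ → ℝ // ∀ j, 0 < x j} => eval x.1 P / ∏ j, x.1 j ^ α j)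
    ⟨0, ?_⟩ ⟨x, hx⟩
  rintro _ ⟨x, rfl⟩
  exact div_nonneg (eval_nonneg_of_coeff_nonneg hP fun j => (x.2 j).le)
    (Finset.prod_nonneg fun j _ => Real.rpow_nonneg (x.2 j).le _)

theorem theorem1 {m : ℕ} (P : MvPolynomial (Fin (m + 1)) ℝ) (hP : IsLorentzian P)
    (n : ℕ) (hn : P.totalDegree = n) (α : Fin (m + 1) → ℝ) (hα : ∀ j, 0 ≤ α j)
    (i : Fin (m + 1)) (k : ℕ) (hk : α i = k) :
    capacity α P *
        ((n.choose k : ℝ) * ((k : ℝ) / n) ^ k * (((n : ℝ) - k) / n) ^ (n - k)) ≤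
      1 / (k.factorial : ℝ) * capacity (i.removeNth α) (derivRestrict i k P) := by
  obtain ⟨d, hd⟩ := hP
  have hfac : (0 : ℝ) < k.factorial := by positivity
  have hnn := hd.coeff_nonneg
  have : Nonempty {x : Fin m → ℝ // ∀ j, 0 < x j} := ⟨⟨1, fun _ => one_pos⟩⟩
  rw [one_div, inv_mul_eq_div, le_div_iff₀ hfac]
  refine le_ciInf fun ⟨y, hy⟩ => ?_
  have hprod : 0 < ∏ j, y j ^ i.removeNth α j :=
    Finset.prod_pos fun j _ => Real.rpow_pos_of_pos (hy j) _
  simp only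
  rw [le_div_iff₀ hprod, eval_derivRestrict, mul_right_comm, mul_comm (k.factorial : ℝ)]
  refine mul_le_mul_of_nonneg_right ?_ hfac.le
  have hc := coeff_specialize_nonneg i hy hnn
  rcases lt_or_ge n k with hnk | hkn
  · rw [Nat.choose_eq_zero_of_lt hnk]
    simpa using hc k
  have hpos : ∀ t : ℝ, 0 < t → ∀ j, 0 < i.insertNth (α := fun _ => ℝ) t y j := by
    intro t ht j
    refine Fin.succAboveCases i ?_ (fun l => ?_) j
    · simpa using ht
    · simpa using hy l
  -- The zero form is Lorentzian of every degree, so `d` need not equal the total degree; its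
  -- capacity is `0`.
  by_cases hP0 : P = 0
  · have h0 : capacity α P ≤ 0 := by
      have := capacity_mul_le_eval α hnn (x := 1) (fun _ => one_pos)
      simpa [hP0] using this
    rw [le_antisymm h0 (capacity_nonneg α hnn)]
    simpa using hc k
  obtain rfl : d = n := by rw [← hn, hd.isHomogeneous.totalDegree hP0]
  rw [mul_right_comm]
  refine mul_le_coeff_of_ultra_log_concave hkn hc (hd.coeff_specialize_ultra_log_concave i hy)
    (fun a j b haj hjb hbn ha hb => hd.coeff_specialize_pos i hy haj hjb hbn ha hb) ?_
  intro t ht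
  rw [← hd.isHomogeneous.eval_insertNth]
  -- The capacity bound at the point with `t` in slot `i`: since `α i = k`, that slot contributes
  -- the integer power `t ^ k`.
  refine le_of_eq_of_le ?_ (capacity_mul_le_eval α hnn (hpos t ht))
  rw [Fin.prod_univ_succAbove _ i]
  simp only [Fin.insertNth_apply_same, Fin.insertNth_apply_succAbove, hk, Real.rpow_natCast,
    Fin.removeNth]
  ring
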